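/- Let $m\ge 1$, let $\mathbb T^m=\mathbb R^m/2\pi\mathbb Z^m$, and identify functions on $\mathbb T^m$ with functions on $\mathbb R^m$ that are $2\pi$-periodic in each variable. For integrable $f$ on $\mathbb T^m$ put $$\widehat f(k)=\frac1{(2\pi)^m}\int_{[0,2\pi]^m} f(t)e^{-i(k,t)}\,dt,\qquad k\in\mathbb Z^m .$$ For $1<p\le2$ let $A_p(\mathbb T^m)$ be the space of integrable functions $f$ on $\mathbb T^m$ with $\widehat f\in\ell^p(\mathbb Z^m)$, let $A_1(\mathbb T^m)$ be the space of continuous functions $f$ on $\mathbb T^m$ with $\widehat f\in\ell^1(\mathbb Z^m)$, and put $\|f\|_{A_p(\mathbb T^m)}=\big(\sum_{k\in\mathbb Z^m}|\widehat f(k)|^p\big)^{1/p}$. Let $\omega$ be a continuous nondecreasing function on $[0,+\infty)$ with $\omega(0)=0$. The class $C^{1,\omega}(\mathbb T^m)$ consists of the $C^1$ functions $f$ on $\mathbb R^m$, $2\pi$-periodic in each variable, such that for each first-order partial derivative $g=\partial f/\partial t_j$ $$\sup_{|t_1-t_2|\le\delta}|g(t_1)-g(t_2)|=O(\omega(\delta)),\qquad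 \delta\to+0 .$$ **Theorem 1.** Let $1\le p<2$, and let $\varphi\in C^{1,\omega}(\mathbb T^m)$ be a real function such that the set $\nabla\varphi(\mathbb T^m)\subseteq\mathbb R^m$ has positive Lebesgue measure. Then the function $\chi(\delta)=\delta\omega(\delta)$ is a bijection of $[0,+\infty)$ onto itself, and, denoting its inverse by $\chi^{-1}$, there is a constant $c>0$, depending on $m$, $p$, $\varphi$ and $\omega$ but not on $\lambda$, such that $$\|e^{i\lambda\varphi}\|_{A_p(\mathbb T^m)}\ \ge\ c\,\Big(|\lambda|^{1/p}\,\chi^{-1}\big(1/|\lambda|\big)\Big)^m$$ for all real $\lambda$ with $|\lambda|\ge1$ that belong to $\Lambda(\varphi,p)=\{\lambda\in\mathbb R:\ e^{i\lambda\varphi}\in A_p(\mathbb T^m)\}$. -/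

import Mathlib

open Filter Topology MeasureTheory
open scoped ENNReal NNReal

noncomputable section

namespace BeurlingHelson

/-- The space `ℝᵐ` with the Euclidean length. Functions on the torus `𝕋ᵐ = ℝᵐ / 2πℤᵐ` are
regarded as functions on `ℝᵐ` that are `2π`-periodic in each variable. -/
abbrev Space (m : ℕ) : Type := EuclideanSpace ℝ (Fin m)

/-- `f` is `2π`-periodic with respect to each variable. -/
def IsTorusPeriodic {m : ℕ} {F : Type*} (f : Space m → F) : Prop :=
  ∀ (t : Space m) (j : Fin m), f (t + EuclideanSpace.single j (2 * Real.pi)) = f t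

/-- The cube `[0, 2π]ᵐ`. -/
def cube (m : ℕ) : Set (Space m) :=
  {t | ∀ j, t j ∈ Set.Icc (0 : ℝ) (2 * Real.pi)}

/-- The Fourier coefficient `(2π)⁻ᵐ ∫_{[0,2π]ᵐ} f(t) e^{-i(k,t)} dt`, for `k ∈ ℤᵐ`. -/
def torusFourierCoeff {m : ℕ} (f : Space m → ℂ) (k : Fin m → ℤ) : ℂ :=
  (1 / (2 * Real.pi : ℂ) ^ m) *
    ∫ t in cube m, f t * Complex.exp (-Complex.I * ((∑ j, (k j : ℝ) * t j : ℝ) : ℂ))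

/-- Membership in `A_p(𝕋ᵐ)`: integrable functions on the torus (continuous ones if `p = 1`) whose
Fourier coefficients form a sequence in `ℓᵖ(ℤᵐ)`. -/
structure MemA {m : ℕ} (p : ℝ) (f : Space m → ℂ) : Prop where
  periodic : IsTorusPeriodic f
  integrable : IntegrableOn f (cube m)
  continuous : p = 1 → Continuous f
  summable : Summable fun k : Fin m → ℤ => ‖torusFourierCoeff f k‖ ^ p

/-- The norm of `A_p(𝕋ᵐ)`: the `ℓᵖ(ℤᵐ)` norm of the Fourier coefficients. -/
def normA {m : ℕ} (p : ℝ) (f : Space m → ℂ) : ℝ :=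
  (∑' k : Fin m → ℤ, ‖torusFourierCoeff f k‖ ^ p) ^ (1 / p)

/-- The function `e^{iλφ}`. -/
def expPhase {m : ℕ} (φ : Space m → ℝ) (lam : ℝ) (t : Space m) : ℂ :=
  Complex.exp (Complex.I * ((lam * φ t : ℝ) : ℂ))

/-- `Λ(φ, p)`: the set of all real `λ` for which `e^{iλφ} ∈ A_p(𝕋ᵐ)`. -/
def Lambda {m : ℕ} (φ : Space m → ℝ) (p : ℝ) : Set ℝ :=
  {lam | MemA p (expPhase φ lam)}

/-- The modulus of continuity `ω(g, δ) = sup {|g(t₁) - g(t₂)| : |t₁ - t₂| ≤ δ}`, with values in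
`[0, ∞]`. -/
def modulus {m : ℕ} {F : Type*} [NormedAddCommGroup F] (g : Space m → F) (δ : ℝ) : ℝ≥0∞ :=
  ⨆ (t₁ : Space m) (t₂ : Space m) (_ : ‖t₁ - t₂‖ ≤ δ), ‖g t₁ - g t₂‖ₑ

/-- `g ∈ Lip_ω(ℝᵐ)`: `ω(g, δ) = O(ω(δ))` as `δ → +0`. -/
def MemLip {m : ℕ} {F : Type*} [NormedAddCommGroup F] (ω : ℝ → ℝ) (g : Space m → F) : Prop :=
  ∃ C : ℝ≥0, ∀ᶠ δ in 𝓝[>] (0 : ℝ), modulus g δ ≤ C * ENNReal.ofReal (ω δ)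

/-- `f ∈ C^{1,ω}(𝕋ᵐ)`: `f` is `2π`-periodic in each variable, is `C¹`, and all its partial
derivatives of first order belong to `Lip_ω(ℝᵐ)`. -/
structure MemC1 {m : ℕ} {F : Type*} [NormedAddCommGroup F] [NormedSpace ℝ F]
    (ω : ℝ → ℝ) (f : Space m → F) : Prop where
  periodic : IsTorusPeriodic f
  contDiff : ContDiff ℝ 1 f
  lip : ∀ j : Fin m, MemLip ω fun t => fderiv ℝ f t (EuclideanSpace.single j 1)

/-- `χ(δ) = δ ω(δ)`. -/
def chi (ω : ℝ → ℝ) (δ : ℝ) : ℝ := δ * ω δ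

/-- The inverse of `χ : [0, ∞) → [0, ∞)`; meaningful when `χ` is a bijection of `[0, ∞)` onto
itself. -/
def chiInv (ω : ℝ → ℝ) : ℝ → ℝ := Function.invFunOn (chi ω) (Set.Ici 0)

end BeurlingHelson

end

namespace BeurlingHelson

/-! The Fourier coefficients of `expPhase φ lam` cannot be small near the frequencies `lam *
∇φ(t₀)`. Put X = χ⁻¹(1/|λ|), so that |λ| X ω(X) = 1. On a cube of side comparable to X about any
point t₀, replacing λφ by its linear part changes the phase by O(|λ| X ω(X)) = O(1), and by little
once the side carries a small factor ε. If n is a lattice point nearest to λ∇φ(t₀), then e^{iλφ}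
e^{-i(n, t - t₀)} is therefore almost constant on that cube.

Testing this product against a nonnegative trigonometric kernel concentrated at t₀ on scale 1/N,
with N of order 1/X, gives at least half of the kernel's mass (`norm_integral_mul_torusKernel_ge`).
Expanding the kernel into exponentials turns this into a lower bound for a sum of coefficients over
a window of width of order N about n (`le_sum_norm_torusFourierCoeff`).

Since ∇φ has a range of measure at least some v > 0, at least |λ|^m v lattice points n arise in this
way (`exists_finset_near_dilate`). Averaging over shifts by the power mean inequality combines the
windows, even when they overlap (`card_rpow_mul_le_normA`), and yields a bound of order (|λ|^{1/p} /
N)^m. -/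

/-! ### Modulus of continuity of the gradient, and the function χ -/

theorem fderiv_single_eq_gradient {m : ℕ} (φ : Space m → ℝ) (t : Space m) (j : Fin m) :
    fderiv ℝ φ t (EuclideanSpace.single j 1) = gradient φ t j := by
  rw [← inner_gradient_left, EuclideanSpace.inner_single_right]
  simp only [one_mul, conj_trivial]

theorem fderiv_apply_eq_sum {m : ℕ} (φ : Space m → ℝ) (t v : Space m) :
    fderiv ℝ φ t v = ∑ j, gradient φ t j * v j := by
  rw [← inner_gradient_left, PiLp.inner_apply]
  simp [mul_comm]

theorem norm_sub_le_of_modulus_le {m : ℕ} {F : Type*} [NormedAddCommGroup F] {g : Space m → F}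
    {δ : ℝ} {C : ℝ≥0} {y : ℝ} (hy : 0 ≤ y) (h : modulus g δ ≤ C * ENNReal.ofReal y)
    {t₁ t₂ : Space m} (ht : ‖t₁ - t₂‖ ≤ δ) : ‖g t₁ - g t₂‖ ≤ C * y := by
  have h1 : ‖g t₁ - g t₂‖ₑ ≤ modulus g δ := by
    unfold modulus
    exact le_iSup_of_le t₁ (le_iSup_of_le t₂ (le_iSup_of_le ht le_rfl))
  have h2 := h1.trans h
  rw [← ofReal_norm, ← ENNReal.ofReal_coe_nnreal, ← ENNReal.ofReal_mul C.coe_nonneg] at h2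
  exact (ENNReal.ofReal_le_ofReal_iff (by positivity)).1 h2

theorem omega_nonneg {ω : ℝ → ℝ} (hω_mono : MonotoneOn ω (Set.Ici 0)) (hω_zero : ω 0 = 0)
    {x : ℝ} (hx : 0 ≤ x) : 0 ≤ ω x :=
  hω_zero ▸ hω_mono (Set.mem_Ici.2 le_rfl) (Set.mem_Ici.2 hx) hx

theorem MemC1.exists_gradient_sub_le {m : ℕ} {ω : ℝ → ℝ} (hω_mono : MonotoneOn ω (Set.Ici 0))
    (hω_zero : ω 0 = 0) {φ : Space m → ℝ} (hφ : MemC1 ω φ) :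
    ∃ C > 0, ∃ δ₀ > 0, ∀ δ, 0 < δ → δ < δ₀ → ∀ j (t₁ t₂ : Space m), ‖t₁ - t₂‖ ≤ δ →
      |gradient φ t₁ j - gradient φ t₂ j| ≤ C * ω δ := by
  choose C hC using hφ.lip
  have hev : ∀ᶠ δ in 𝓝[>] (0 : ℝ), ∀ j,
      modulus (fun t => fderiv ℝ φ t (EuclideanSpace.single j 1)) δ ≤
        C j * ENNReal.ofReal (ω δ) := eventually_all.2 hC
  obtain ⟨δ₀, hδ₀, h⟩ := mem_nhdsGT_iff_exists_Ioo_subset.1 hev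
  -- One constant serves all coordinates; the added 1 keeps it positive even if every `C j` is zero.
  refine ⟨∑ j, (C j : ℝ) + 1, by positivity, δ₀, hδ₀, fun δ h0 h1 j t₁ t₂ ht => ?_⟩
  have hω := omega_nonneg hω_mono hω_zero h0.le
  have h2 := norm_sub_le_of_modulus_le hω (h ⟨h0, h1⟩ j) ht
  simp only [fderiv_single_eq_gradient, Real.norm_eq_abs] at h2
  refine h2.trans (mul_le_mul_of_nonneg_right ?_ hω)
  have := Finset.single_le_sum (f := fun j => (C j : ℝ)) (fun i _ => (C i).2) (Finset.mem_univ j)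
  linarith

/-- If ω vanished at some x > 0, the gradient would not vary over short distances. It would be
locally constant, hence constant by connectedness, and its range would be a single point, which is
null because `1 ≤ m`. -/
theorem MemC1.omega_pos {m : ℕ} (hm : 1 ≤ m) {ω : ℝ → ℝ} (hω_mono : MonotoneOn ω (Set.Ici 0))
    (hω_zero : ω 0 = 0) {φ : Space m → ℝ} (hφ : MemC1 ω φ)
    (hgrad : 0 < volume (Set.range (gradient φ))) {x : ℝ} (hx : 0 < x) : 0 < ω x := by
  by_contra hneg
  obtain ⟨C, hC, δ₀, hδ₀, h⟩ := hφ.exists_gradient_sub_le hω_mono hω_zero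
  set δ := min x (δ₀ / 2) with hδ
  have hδ0 : 0 < δ := lt_min hx (by positivity)
  have hωδ : ω δ ≤ 0 :=
    (hω_mono hδ0.le hx.le (min_le_left _ _)).trans (not_lt.1 hneg)
  have hlc : IsLocallyConstant (gradient φ) := by
    rw [IsLocallyConstant.iff_eventually_eq]
    intro t
    filter_upwards [Metric.closedBall_mem_nhds t hδ0] with s hs
    ext j
    have h1 := h δ hδ0 (lt_of_le_of_lt (min_le_right _ _) (by linarith)) j s t
      (by rwa [← dist_eq_norm])
    have h2 : |gradient φ s j - gradient φ t j| ≤ 0 :=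
      h1.trans (mul_nonpos_of_nonneg_of_nonpos hC.le hωδ)
    exact sub_eq_zero.1 (abs_nonpos_iff.1 h2)
  have : Nonempty (Fin m) := ⟨⟨0, hm⟩⟩
  have hsub : Set.range (gradient φ) ⊆ {gradient φ 0} := by
    rintro _ ⟨t, rfl⟩
    exact hlc.apply_eq_of_isPreconnected isPreconnected_univ (Set.mem_univ _) (Set.mem_univ _)
  exact hgrad.ne' (measure_mono_null hsub (measure_singleton _))

theorem strictMonoOn_chi {ω : ℝ → ℝ} (hω_mono : MonotoneOn ω (Set.Ici 0))
    (hω_pos : ∀ x, 0 < x → 0 < ω x) : StrictMonoOn (chi ω) (Set.Ici 0) := by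
  intro x hx y hy hxy
  have hy0 : 0 < y := lt_of_le_of_lt hx hxy
  calc x * ω x ≤ x * ω y := mul_le_mul_of_nonneg_left (hω_mono hx hy hxy.le) hx
    _ < y * ω y := mul_lt_mul_of_pos_right hxy (hω_pos y hy0)

theorem bijOn_chi {ω : ℝ → ℝ} (hω_cont : ContinuousOn ω (Set.Ici 0))
    (hω_mono : MonotoneOn ω (Set.Ici 0)) (hω_zero : ω 0 = 0)
    (hω_pos : ∀ x, 0 < x → 0 < ω x) : Set.BijOn (chi ω) (Set.Ici 0) (Set.Ici 0) := by
  refine ⟨fun x hx => mul_nonneg hx (omega_nonneg hω_mono hω_zero hx),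
    (strictMonoOn_chi hω_mono hω_pos).injOn, fun y hy => ?_⟩
  have hy0 : (0 : ℝ) ≤ y := hy
  -- Beyond 1 monotonicity gives χ(M) ≥ M ω(1), so this M is large enough for the intermediate value
  -- theorem.
  set M : ℝ := max 1 (y / ω 1) with hM
  have h1 := hω_pos 1 one_pos
  have hM1 : 1 ≤ M := le_max_left _ _
  have hMy : y ≤ chi ω M := by
    calc y = y / ω 1 * ω 1 := by field_simp
      _ ≤ M * ω 1 := mul_le_mul_of_nonneg_right (le_max_right _ _) h1.le
      _ ≤ M * ω M := mul_le_mul_of_nonneg_left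
          (hω_mono (by simp) (by simp; linarith) hM1) (by linarith)
  have hsub : Set.Icc 0 M ⊆ Set.Ici (0 : ℝ) := fun z hz => hz.1
  have hcont : ContinuousOn (chi ω) (Set.Icc 0 M) :=
    continuousOn_id.mul (hω_cont.mono hsub)
  have hmem : y ∈ Set.Icc (chi ω 0) (chi ω M) := ⟨by simpa [chi] using hy0, hMy⟩
  obtain ⟨x, hx, hxy⟩ := intermediate_value_Icc (by linarith : (0 : ℝ) ≤ M) hcont hmem
  exact ⟨x, hsub hx, hxy⟩


/-! ### Trigonometric polynomials and the kernel in one variable -/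

theorem integral_exp_int_mul (n : ℤ) :
    ∫ s in (0 : ℝ)..2 * Real.pi, Complex.exp (Complex.I * ((n * s : ℝ) : ℂ)) =
      if n = 0 then 2 * (Real.pi : ℂ) else 0 := by
  split_ifs with h
  · simp [h]
  · have hn : (n : ℂ) ≠ 0 := by exact_mod_cast h
    have hc : Complex.I * (n : ℂ) ≠ 0 := mul_ne_zero Complex.I_ne_zero hn
    have h1 := integral_exp_mul_complex (a := 0) (b := 2 * Real.pi) hc
    have h2 : Complex.exp (Complex.I * n * ((2 * Real.pi : ℝ) : ℂ)) = 1 := by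
      rw [← Complex.exp_int_mul_two_pi_mul_I n]
      congr 1
      push_cast
      ring
    rw [h2] at h1
    simp only [Complex.ofReal_zero, mul_zero, Complex.exp_zero, sub_self, zero_div] at h1
    rw [← h1]
    congr 1
    funext s
    push_cast
    ring_nf

/-- The trigonometric polynomial `∑_{j < N} a_j e^{ijs}`. -/
noncomputable def trigPoly (a : ℕ → ℝ) (N : ℕ) (s : ℝ) : ℂ :=
  ∑ j ∈ Finset.range N, (a j : ℂ) * Complex.exp (Complex.I * ((j * s : ℝ) : ℂ))

theorem continuous_trigPoly (a : ℕ → ℝ) (N : ℕ) : Continuous (trigPoly a N) := by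
  unfold trigPoly
  fun_prop

theorem norm_sq_trigPoly (a : ℕ → ℝ) (N : ℕ) (s : ℝ) :
    ((‖trigPoly a N s‖ ^ 2 : ℝ) : ℂ) =
      ∑ x ∈ Finset.range N ×ˢ Finset.range N, ((a x.1 * a x.2 : ℝ) : ℂ) *
        Complex.exp (Complex.I * ((((x.1 : ℤ) - (x.2 : ℤ) : ℤ) * s : ℝ) : ℂ)) := by
  rw [← Complex.normSq_eq_norm_sq, ← Complex.mul_conj]
  unfold trigPoly
  rw [map_sum, Finset.sum_mul_sum, Finset.sum_product]
  refine Finset.sum_congr rfl fun j _ => Finset.sum_congr rfl fun l _ => ?_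
  rw [map_mul, ← Complex.exp_conj, mul_mul_mul_comm, ← Complex.exp_add]
  simp only [Complex.conj_ofReal, map_mul, Complex.conj_I]
  congr 1
  · push_cast; ring
  · congr 1; push_cast; ring

theorem integral_norm_sq_trigPoly (a : ℕ → ℝ) (N : ℕ) :
    ∫ s in (0 : ℝ)..2 * Real.pi, ‖trigPoly a N s‖ ^ 2 =
      2 * Real.pi * ∑ j ∈ Finset.range N, a j ^ 2 := by
  have key : ((∫ s in (0 : ℝ)..2 * Real.pi, ‖trigPoly a N s‖ ^ 2 : ℝ) : ℂ) =
      ((2 * Real.pi * ∑ j ∈ Finset.range N, a j ^ 2 : ℝ) : ℂ) := by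
    rw [← intervalIntegral.integral_ofReal]
    simp only [norm_sq_trigPoly]
    rw [intervalIntegral.integral_finsetSum
      (fun x _ => (Continuous.intervalIntegrable (by fun_prop) _ _))]
    simp only [intervalIntegral.integral_const_mul, integral_exp_int_mul]
    rw [Finset.sum_product]
    push_cast
    rw [Finset.mul_sum]
    refine Finset.sum_congr rfl fun j hj => ?_
    rw [Finset.sum_eq_single j]
    · simp; ring
    · intro l _ hl
      have : ¬ ((j : ℤ) - (l : ℤ) = 0) := by omega
      simp [this]
    · intro h; exact absurd hj h
  exact_mod_cast key

/-- Summation by parts. At j = 0 truncated subtraction makes the difference 0, which agrees with the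
true value `a 0` only because `a 0 = 0`. -/
theorem one_sub_exp_mul_trigPoly {a : ℕ → ℝ} (h0 : a 0 = 0) (N : ℕ) (s : ℝ) :
    (1 - Complex.exp (Complex.I * (s : ℂ))) * trigPoly a N s =
      trigPoly (fun j => a j - a (j - 1)) (N + 1) s -
        (a N : ℂ) * Complex.exp (Complex.I * ((N * s : ℝ) : ℂ)) := by
  induction N with
  | zero => simp [trigPoly, h0]
  | succ N ih =>
    have e1 : trigPoly a (N + 1) s =
        trigPoly a N s + (a N : ℂ) * Complex.exp (Complex.I * ((N * s : ℝ) : ℂ)) :=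
      Finset.sum_range_succ _ _
    have e2 : trigPoly (fun j => a j - a (j - 1)) (N + 1 + 1) s =
        trigPoly (fun j => a j - a (j - 1)) (N + 1) s + ((a (N + 1) - a N : ℝ) : ℂ) *
          Complex.exp (Complex.I * (((N + 1 : ℕ) * s : ℝ) : ℂ)) :=
      Finset.sum_range_succ _ _
    have e3 : Complex.exp (Complex.I * (((N + 1 : ℕ) * s : ℝ) : ℂ)) =
        Complex.exp (Complex.I * (s : ℂ)) * Complex.exp (Complex.I * ((N * s : ℝ) : ℂ)) := by
      rw [← Complex.exp_add]; congr 1; push_cast; ring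
    rw [e1, e2, mul_add, ih, e3]
    push_cast
    ring

theorem norm_sq_one_sub_exp (s : ℝ) :
    ‖1 - Complex.exp (Complex.I * (s : ℂ))‖ ^ 2 = 2 * (1 - Real.cos s) := by
  rw [← Complex.normSq_eq_norm_sq, mul_comm, Complex.exp_mul_I, Complex.normSq_apply]
  simp [Complex.cos_ofReal_re, Complex.sin_ofReal_re]
  nlinarith [Real.sin_sq_add_cos_sq s]

/-- Since 1 - cos s = |1 - e^{is}|²/2, Parseval turns the spread of |P|² about 0 into the energy of
the differences of its coefficients. Vanishing at both ends removes the boundary terms. -/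
theorem integral_one_sub_cos_mul_norm_sq_trigPoly {a : ℕ → ℝ} {N : ℕ} (h0 : a 0 = 0)
    (hN : a N = 0) :
    ∫ s in (0 : ℝ)..2 * Real.pi, (1 - Real.cos s) * ‖trigPoly a N s‖ ^ 2 =
      Real.pi * ∑ j ∈ Finset.range (N + 1), (a j - a (j - 1)) ^ 2 := by
  have h : ∀ s, (1 - Real.cos s) * ‖trigPoly a N s‖ ^ 2 =
      2⁻¹ * ‖trigPoly (fun j => a j - a (j - 1)) (N + 1) s‖ ^ 2 := by
    intro s
    have := one_sub_exp_mul_trigPoly h0 N s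
    rw [hN] at this
    simp only [Complex.ofReal_zero, zero_mul, sub_zero] at this
    rw [← this, norm_mul, mul_pow, norm_sq_one_sub_exp]
    ring
  simp only [h, intervalIntegral.integral_const_mul, integral_norm_sq_trigPoly]
  ring

/-- The coefficients `j (N - j)` of the localizing kernel. -/
def parabola (N j : ℕ) : ℝ := j * (N - j)

theorem parabola_nonneg {N j : ℕ} (h : j ≤ N) : 0 ≤ parabola N j :=
  mul_nonneg (by positivity) (sub_nonneg.2 (by exact_mod_cast h))

theorem parabola_le (N j : ℕ) : parabola N j ≤ (N : ℝ) ^ 2 / 4 := by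
  unfold parabola
  nlinarith [sq_nonneg ((N : ℝ) - 2 * j)]

theorem sum_parabola_sq (N : ℕ) :
    ∑ j ∈ Finset.range N, parabola N j ^ 2 = (N : ℝ) * (N ^ 4 - 1) / 30 := by
  -- The summand depends on N, so the induction runs over a separate upper limit n, later set equal
  -- to N.
  have h : ∀ n : ℕ, ∑ j ∈ Finset.range n, parabola N j ^ 2 =
      (N : ℝ) ^ 2 * ((n - 1) * n * (2 * n - 1) / 6) - 2 * N * (n * (n - 1) / 2) ^ 2 +
        (n - 1) * n * (2 * n - 1) * (3 * n ^ 2 - 3 * n - 1) / 30 := by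
    intro n
    induction n with
    | zero => simp
    | succ n ih => rw [Finset.sum_range_succ, ih]; unfold parabola; push_cast; ring
  rw [h]; ring

theorem le_sum_parabola_sq {N : ℕ} (hN : 2 ≤ N) :
    (N : ℝ) ^ 5 / 40 ≤ ∑ j ∈ Finset.range N, parabola N j ^ 2 := by
  rw [sum_parabola_sq]
  have h2 : (2 : ℝ) ≤ N := by exact_mod_cast hN
  have h4 : (2 : ℝ) ^ 4 ≤ (N : ℝ) ^ 4 := by gcongr
  nlinarith

theorem sum_parabola_sub_sq_le {N : ℕ} (hN : 2 ≤ N) :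
    ∑ j ∈ Finset.range (N + 1), (parabola N j - parabola N (j - 1)) ^ 2 ≤ 2 * (N : ℝ) ^ 3 := by
  have h2 : (2 : ℝ) ≤ N := by exact_mod_cast hN
  have h : ∀ j ∈ Finset.range (N + 1),
      (parabola N j - parabola N (j - 1)) ^ 2 ≤ (N : ℝ) ^ 2 := by
    intro j hj
    have hj : j ≤ N := by simpa [Nat.lt_succ_iff] using hj
    rcases j with _ | j
    · simp
    · have h1 : (j : ℝ) + 1 ≤ N := by exact_mod_cast hj
      have h3 : (0 : ℝ) ≤ j := by positivity
      have e : parabola N (j + 1) - parabola N (j + 1 - 1) = N - 2 * j - 1 := by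
        simp only [parabola, Nat.add_sub_cancel]; push_cast; ring
      rw [e]
      exact sq_le_sq' (by linarith) (by linarith)
  refine (Finset.sum_le_sum h).trans ?_
  simp only [Finset.sum_const, Finset.card_range, nsmul_eq_mul]
  push_cast
  nlinarith [pow_pos (by linarith : (0 : ℝ) < N) 2]

/-- The localizing kernel `|∑_{j < N} j (N - j) e^{ijs}|²`. -/
noncomputable def kernel (N : ℕ) (s : ℝ) : ℝ := ‖trigPoly (parabola N) N s‖ ^ 2

/-- The mean value of the localizing kernel. -/
noncomputable def kernelMass (N : ℕ) : ℝ := ∑ j ∈ Finset.range N, parabola N j ^ 2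

theorem kernel_nonneg (N : ℕ) (s : ℝ) : 0 ≤ kernel N s := by unfold kernel; positivity

theorem continuous_kernel (N : ℕ) : Continuous (kernel N) :=
  (continuous_trigPoly _ _).norm.pow 2

theorem periodic_kernel (N : ℕ) : Function.Periodic (kernel N) (2 * Real.pi) := by
  intro s
  unfold kernel trigPoly
  congr 2
  refine Finset.sum_congr rfl fun j _ => ?_
  congr 1
  rw [← mul_one (Complex.exp (Complex.I * ((j * s : ℝ) : ℂ))),
    ← Complex.exp_nat_mul_two_pi_mul_I j, ← Complex.exp_add]
  congr 1
  push_cast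
  ring

theorem integral_kernel (N : ℕ) (c : ℝ) :
    ∫ s in (0 : ℝ)..2 * Real.pi, kernel N (s - c) = 2 * Real.pi * kernelMass N := by
  rw [intervalIntegral.integral_comp_sub_right (kernel N)]
  have := (periodic_kernel N).intervalIntegral_add_eq (0 - c) 0
  rw [zero_add, show 0 - c + 2 * Real.pi = 2 * Real.pi - c by ring] at this
  rw [this]
  exact integral_norm_sq_trigPoly _ _

/-- Concentration on scale 1/N: the mass is at least of order N⁵, while the difference energy is at
most of order N³. -/
theorem integral_one_sub_cos_mul_kernel_le {N : ℕ} (hN : 2 ≤ N) (c : ℝ) :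
    ∫ s in (0 : ℝ)..2 * Real.pi, (1 - Real.cos (s - c)) * kernel N (s - c) ≤
      2 * Real.pi * kernelMass N * (40 / (N : ℝ) ^ 2) := by
  rw [intervalIntegral.integral_comp_sub_right (fun s => (1 - Real.cos s) * kernel N s)]
  have hper : Function.Periodic (fun s => (1 - Real.cos s) * kernel N s) (2 * Real.pi) := by
    intro s
    simp only [Real.cos_add_two_pi, periodic_kernel N s]
  have := hper.intervalIntegral_add_eq (0 - c) 0
  rw [zero_add, show 0 - c + 2 * Real.pi = 2 * Real.pi - c by ring] at this
  rw [this]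
  unfold kernel
  rw [integral_one_sub_cos_mul_norm_sq_trigPoly (by simp [parabola]) (by simp [parabola])]
  have hN0 : (0 : ℝ) < N := by positivity
  have h1 := sum_parabola_sub_sq_le hN
  have h2 : 2 * (N : ℝ) ^ 3 ≤ 2 * (kernelMass N * (40 / (N : ℝ) ^ 2)) := by
    have := mul_le_mul_of_nonneg_right (le_sum_parabola_sq hN)
      (by positivity : 0 ≤ 40 / (N : ℝ) ^ 2)
    have e : (N : ℝ) ^ 5 / 40 * (40 / (N : ℝ) ^ 2) = (N : ℝ) ^ 3 := by field_simp
    rw [e] at this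
    unfold kernelMass
    linarith
  calc _ ≤ Real.pi * (2 * (kernelMass N * (40 / (N : ℝ) ^ 2))) :=
        mul_le_mul_of_nonneg_left (h1.trans h2) Real.pi_pos.le
    _ = _ := by ring


/-! ### The product kernel on the torus -/

theorem cube_eq_preimage (m : ℕ) : cube m =
    (WithLp.ofLp : Space m → Fin m → ℝ) ⁻¹'
      (Set.univ.pi fun _ => Set.Icc (0 : ℝ) (2 * Real.pi)) := by
  ext t
  simp only [cube, Set.mem_ofPred_eq, Set.mem_preimage, Set.mem_univ_pi]

theorem isCompact_cube (m : ℕ) : IsCompact (cube m) := by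
  rw [cube_eq_preimage]
  exact (EuclideanSpace.equiv (Fin m) ℝ).toHomeomorph.isClosedEmbedding.isCompact_preimage
    (isCompact_univ_pi fun _ => isCompact_Icc)

theorem integral_cube_prod {𝕜 : Type*} [RCLike 𝕜] {m : ℕ} (h : Fin m → ℝ → 𝕜) :
    ∫ t in cube m, ∏ j, h j (t j) = ∏ j, ∫ s in (0 : ℝ)..2 * Real.pi, h j s := by
  rw [cube_eq_preimage,
    (PiLp.volume_preserving_ofLp (Fin m)).setIntegral_preimage_emb
      (MeasurableEquiv.toLp 2 (Fin m → ℝ)).symm.measurableEmbedding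
      (fun t => ∏ j, h j (t j)), volume_pi, Measure.restrict_pi_pi, integral_fintype_prod_eq_prod]
  refine Finset.prod_congr rfl fun j _ => ?_
  rw [intervalIntegral.integral_of_le (by positivity), integral_Icc_eq_integral_Ioc]

/-- The product kernel centred at `t₀`. -/
noncomputable def torusKernel {m : ℕ} (N : ℕ) (t₀ t : Space m) : ℝ :=
  ∏ j, kernel N (t j - t₀ j)

theorem torusKernel_nonneg {m : ℕ} (N : ℕ) (t₀ t : Space m) : 0 ≤ torusKernel N t₀ t :=
  Finset.prod_nonneg fun _ _ => kernel_nonneg _ _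

theorem continuous_torusKernel {m : ℕ} (N : ℕ) (t₀ : Space m) :
    Continuous (torusKernel N t₀) := by
  unfold torusKernel
  have := continuous_kernel N
  fun_prop

theorem integral_torusKernel {m : ℕ} (N : ℕ) (t₀ : Space m) :
    ∫ t in cube m, torusKernel N t₀ t = (2 * Real.pi * kernelMass N) ^ m := by
  unfold torusKernel
  rw [integral_cube_prod (fun j s => kernel N (s - t₀ j))]
  simp only [integral_kernel, Finset.prod_const, Finset.card_univ, Fintype.card_fin]

theorem integral_one_sub_cos_mul_torusKernel_le {m : ℕ} {N : ℕ} (hN : 2 ≤ N) (t₀ : Space m)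
    (i : Fin m) :
    ∫ t in cube m, (1 - Real.cos (t i - t₀ i)) * torusKernel N t₀ t ≤
      (2 * Real.pi * kernelMass N) ^ m * (40 / (N : ℝ) ^ 2) := by
  have e : ∀ t : Space m, (1 - Real.cos (t i - t₀ i)) * torusKernel N t₀ t =
      ∏ j, (if j = i then 1 - Real.cos (t j - t₀ j) else 1) * kernel N (t j - t₀ j) := by
    intro t
    rw [Finset.prod_mul_distrib, Finset.prod_ite_eq' Finset.univ i]
    simp [torusKernel]
  simp only [e]
  rw [integral_cube_prod
    (fun j s => (if j = i then 1 - Real.cos (s - t₀ j) else 1) * kernel N (s - t₀ j))]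
  have hM : 0 ≤ 2 * Real.pi * kernelMass N := by
    have := Finset.sum_nonneg fun j (_ : j ∈ Finset.range N) => sq_nonneg (parabola N j)
    unfold kernelMass; positivity
  have hle : ∀ j, ∫ s in (0 : ℝ)..2 * Real.pi,
      (if j = i then 1 - Real.cos (s - t₀ j) else 1) * kernel N (s - t₀ j) ≤
      (2 * Real.pi * kernelMass N) * (if j = i then 40 / (N : ℝ) ^ 2 else 1) := by
    intro j
    by_cases h : j = i <;> simp only [h, if_true, if_false]
    · exact integral_one_sub_cos_mul_kernel_le hN _
    · simp only [one_mul, mul_one, integral_kernel, le_refl]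
  refine (Finset.prod_le_prod (fun j _ => ?_) fun j _ => hle j).trans_eq ?_
  · refine intervalIntegral.integral_nonneg (by positivity) fun s _ => ?_
    refine mul_nonneg ?_ (kernel_nonneg _ _)
    split_ifs
    · linarith [Real.cos_le_one (s - t₀ j)]
    · exact zero_le_one
  · rw [Finset.prod_mul_distrib, Finset.prod_ite_eq' Finset.univ i]
    simp

/-- With M the mass of the kernel, the constant 1/8 and the cosine terms each contribute at most M/8
to the error, so the integral lies within M/4 of zM. -/
theorem norm_integral_mul_torusKernel_ge {m : ℕ} {N : ℕ} (hN : 2 ≤ N) {t₀ : Space m}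
    {g : Space m → ℂ} (hg : Continuous g) {z : ℂ} (hz : ‖z‖ = 1) {A : ℝ} (hA : 0 ≤ A)
    (hAN : A * (m * (40 / (N : ℝ) ^ 2)) ≤ 1 / 8)
    (hgz : ∀ t, ‖g t - z‖ ≤ 1 / 8 + A * ∑ j, (1 - Real.cos (t j - t₀ j))) :
    (2 * Real.pi * kernelMass N) ^ m / 2 ≤
      ‖∫ t in cube m, g t * (torusKernel N t₀ t : ℂ)‖ := by
  have hK := continuous_torusKernel N t₀
  have hint : ∀ {E : Type} [NormedAddCommGroup E] {u : Space m → E}, Continuous u →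
      IntegrableOn u (cube m) := fun hu => hu.continuousOn.integrableOn_compact (isCompact_cube m)
  set M : ℝ := (2 * Real.pi * kernelMass N) ^ m with hM
  have hM0 : 0 ≤ M := by
    have := Finset.sum_nonneg fun j (_ : j ∈ Finset.range N) => sq_nonneg (parabola N j)
    rw [hM]; unfold kernelMass; positivity
  have hKc : ∫ t in cube m, (torusKernel N t₀ t : ℂ) = M := by
    rw [integral_complex_ofReal, integral_torusKernel]
  have hcos : ∀ i : Fin m, Continuous fun t : Space m =>
      (1 - Real.cos (t i - t₀ i)) * torusKernel N t₀ t := by intro i; fun_prop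
  have hdiff : ‖(∫ t in cube m, g t * (torusKernel N t₀ t : ℂ)) - z * M‖ ≤ M / 4 := by
    rw [← hKc, ← integral_const_mul, ← integral_sub (hint (by fun_prop)) (hint (by fun_prop))]
    refine (norm_integral_le_of_norm_le (g := fun t => 1 / 8 * torusKernel N t₀ t +
      A * ∑ j, (1 - Real.cos (t j - t₀ j)) * torusKernel N t₀ t)
      (hint (by fun_prop)) (Eventually.of_forall fun t => ?_)).trans ?_
    · rw [← sub_mul, norm_mul, Complex.norm_of_nonneg (torusKernel_nonneg N t₀ t),
        ← Finset.sum_mul, ← mul_assoc, ← add_mul]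
      exact mul_le_mul_of_nonneg_right (hgz t) (torusKernel_nonneg N t₀ t)
    · rw [integral_add (hint (by fun_prop)) (hint (by fun_prop)), integral_const_mul,
        integral_const_mul, integral_finsetSum _ (fun i _ => hint (hcos i)),
        integral_torusKernel]
      have h1 : ∑ i : Fin m, ∫ t in cube m, (1 - Real.cos (t i - t₀ i)) * torusKernel N t₀ t ≤
          m * (M * (40 / (N : ℝ) ^ 2)) := by
        refine (Finset.sum_le_sum fun i _ =>
          integral_one_sub_cos_mul_torusKernel_le hN t₀ i).trans_eq ?_
        simp [hM]
      have h2 := mul_le_mul_of_nonneg_left h1 hA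
      have h3 := mul_le_mul_of_nonneg_right hAN hM0
      rw [← hM]
      nlinarith
  have hzM : ‖z * (M : ℂ)‖ = M := by rw [norm_mul, hz, one_mul, Complex.norm_of_nonneg hM0]
  have := norm_sub_norm_le (z * (M : ℂ)) (∫ t in cube m, g t * (torusKernel N t₀ t : ℂ))
  rw [norm_sub_rev] at this
  linarith

theorem torusKernel_eq_sum {m : ℕ} (N : ℕ) (t₀ t : Space m) :
    (torusKernel N t₀ t : ℂ) =
      ∑ x ∈ Fintype.piFinset fun _ : Fin m => Finset.range N ×ˢ Finset.range N,
        ((∏ j, parabola N (x j).1 * parabola N (x j).2 : ℝ) : ℂ) *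
          Complex.exp (Complex.I *
            ((∑ j, (((x j).1 : ℤ) - ((x j).2 : ℤ) : ℤ) * (t j - t₀ j) : ℝ) : ℂ)) := by
  unfold torusKernel kernel
  rw [Complex.ofReal_prod]
  simp only [norm_sq_trigPoly]
  rw [Finset.prod_univ_sum]
  refine Finset.sum_congr rfl fun x _ => ?_
  rw [Finset.prod_mul_distrib, ← Complex.exp_sum, ← Finset.mul_sum]
  push_cast
  rfl

/-- Each exponential in the expanded kernel shifts the frequency n, leaving one Fourier coefficient
of f. Its weight is a product of m pairs of parabola values, each value at most N²/4. -/
theorem norm_integral_mul_torusKernel_le {m : ℕ} {f : Space m → ℂ}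
    (hf : IntegrableOn f (cube m)) (n : Fin m → ℤ) (t₀ : Space m) (N : ℕ) :
    ‖∫ t in cube m, f t * Complex.exp (-Complex.I * ((∑ j, n j * (t j - t₀ j) : ℝ) : ℂ)) *
        (torusKernel N t₀ t : ℂ)‖ ≤
      (2 * Real.pi) ^ m * ((N : ℝ) ^ 4 / 16) ^ m *
        ∑ x ∈ Fintype.piFinset fun _ : Fin m => Finset.range N ×ˢ Finset.range N,
          ‖torusFourierCoeff f fun j => n j - (x j).1 + (x j).2‖ := by
  have e : ∀ t : Space m,
      f t * Complex.exp (-Complex.I * ((∑ j, n j * (t j - t₀ j) : ℝ) : ℂ)) *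
        (torusKernel N t₀ t : ℂ) =
      ∑ x ∈ Fintype.piFinset fun _ : Fin m => Finset.range N ×ˢ Finset.range N,
        (((∏ j, parabola N (x j).1 * parabola N (x j).2 : ℝ) : ℂ) *
          Complex.exp (Complex.I *
            ((∑ j, (n j - (x j).1 + (x j).2 : ℤ) * t₀ j : ℝ) : ℂ))) *
        (f t * Complex.exp (-Complex.I *
            ((∑ j, ((n j - (x j).1 + (x j).2 : ℤ) : ℝ) * t j : ℝ) : ℂ))) := by
    intro t
    rw [torusKernel_eq_sum, Finset.mul_sum]
    refine Finset.sum_congr rfl fun x _ => ?_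
    have hexp : Complex.exp (-Complex.I * ((∑ j, n j * (t j - t₀ j) : ℝ) : ℂ)) *
        Complex.exp (Complex.I *
          ((∑ j, (((x j).1 : ℤ) - ((x j).2 : ℤ) : ℤ) * (t j - t₀ j) : ℝ) : ℂ)) =
        Complex.exp (Complex.I *
          ((∑ j, (n j - (x j).1 + (x j).2 : ℤ) * t₀ j : ℝ) : ℂ)) *
        Complex.exp (-Complex.I *
          ((∑ j, ((n j - (x j).1 + (x j).2 : ℤ) : ℝ) * t j : ℝ) : ℂ)) := by
      rw [← Complex.exp_add, ← Complex.exp_add, neg_mul, neg_mul, neg_add_eq_sub, ← sub_eq_add_neg,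
        ← mul_sub, ← mul_sub, ← Complex.ofReal_sub, ← Complex.ofReal_sub, ← Finset.sum_sub_distrib,
        ← Finset.sum_sub_distrib]
      congr 3
      refine Finset.sum_congr rfl fun j _ => ?_
      push_cast
      ring
    linear_combination (f t * ((∏ j, parabola N (x j).1 * parabola N (x j).2 : ℝ) : ℂ)) * hexp
  have hint : ∀ k : Fin m → ℤ, IntegrableOn (fun t => f t * Complex.exp (-Complex.I *
      ((∑ j, (k j : ℝ) * t j : ℝ) : ℂ))) (cube m) := fun k =>
    hf.mul_continuousOn (Continuous.continuousOn (by fun_prop)) (isCompact_cube m)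
  simp only [e]
  rw [integral_finsetSum _ fun x _ => (hint _).const_mul _, Finset.mul_sum]
  refine (norm_sum_le _ _).trans (Finset.sum_le_sum fun x hx => ?_)
  rw [integral_const_mul, norm_mul, norm_mul, mul_comm Complex.I, Complex.norm_exp_ofReal_mul_I,
    mul_one, Complex.norm_real, Real.norm_eq_abs]
  have hpi : ((2 * Real.pi : ℂ) ^ m) ≠ 0 :=
    pow_ne_zero _ (mul_ne_zero two_ne_zero (by exact_mod_cast Real.pi_ne_zero))
  have hcoef : ∀ k : Fin m → ℤ, ‖∫ t in cube m, f t * Complex.exp (-Complex.I *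
      ((∑ j, (k j : ℝ) * t j : ℝ) : ℂ))‖ = (2 * Real.pi) ^ m * ‖torusFourierCoeff f k‖ := by
    intro k
    have h2 : ‖(2 * Real.pi : ℂ) ^ m‖ = (2 * Real.pi) ^ m := by
      rw [norm_pow, norm_mul, Complex.norm_of_nonneg Real.pi_pos.le]; simp
    rw [← h2, ← norm_mul]
    unfold torusFourierCoeff
    rw [← mul_assoc, mul_one_div_cancel hpi, one_mul]
  rw [hcoef]
  have hprod : |∏ j, parabola N (x j).1 * parabola N (x j).2| ≤ ((N : ℝ) ^ 4 / 16) ^ m := by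
    rw [Finset.abs_prod]
    refine (Finset.prod_le_prod (g := fun _ => (N : ℝ) ^ 4 / 16) (fun j _ => abs_nonneg _)
      fun j _ => ?_).trans_eq (by simp only [Finset.prod_const, Finset.card_univ, Fintype.card_fin])
    have hxj := Finset.mem_product.1 (Fintype.mem_piFinset.1 hx j)
    have h1 := parabola_nonneg (Finset.mem_range.1 hxj.1).le
    have h2 := parabola_nonneg (Finset.mem_range.1 hxj.2).le
    rw [abs_of_nonneg (mul_nonneg h1 h2)]
    refine (mul_le_mul (parabola_le N _) (parabola_le N _) h2 (by positivity)).trans_eq ?_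
    ring
  rw [mul_comm ((2 * Real.pi) ^ m) (((N : ℝ) ^ 4 / 16) ^ m), mul_assoc]
  exact mul_le_mul_of_nonneg_right hprod (by positivity)


/-! ### Combining windows, and counting lattice points -/

/-- The power mean inequality over the N^{2m} shifts bounds `B ^ p`. After summing over `T` and
exchanging the sums, each fixed shift is injective in n and so costs at most the full ℓᵖ sum.
Disjointness of the windows is not needed. -/
theorem card_rpow_mul_le_normA {m : ℕ} {p : ℝ} (hp : 1 ≤ p) {f : Space m → ℂ}
    (hs : Summable fun k : Fin m → ℤ => ‖torusFourierCoeff f k‖ ^ p) {N : ℕ} {B : ℝ}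
    (hB : 0 ≤ B) (T : Finset (Fin m → ℤ))
    (hT : ∀ n ∈ T, B ≤ ∑ x ∈ Fintype.piFinset fun _ : Fin m => Finset.range N ×ˢ Finset.range N,
      ‖torusFourierCoeff f fun j => n j - (x j).1 + (x j).2‖) :
    (T.card : ℝ) ^ (1 / p) * B ≤ ((N : ℝ) ^ 2) ^ m * normA p f := by
  have hp0 : 0 < p := by linarith
  set P := Fintype.piFinset fun _ : Fin m => Finset.range N ×ˢ Finset.range N with hP
  have hPc : (P.card : ℝ) = ((N : ℝ) ^ 2) ^ m := by
    rw [hP, Fintype.card_piFinset]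
    simp [sq]
  set W : ℝ := ∑' k : Fin m → ℤ, ‖torusFourierCoeff f k‖ ^ p with hW
  have hW0 : 0 ≤ W := tsum_nonneg fun k => by positivity
  have hshift : ∀ d : Fin m → ℤ, ∑ n ∈ T, ‖torusFourierCoeff f (n + d)‖ ^ p ≤ W := by
    intro d
    have h1 : Summable fun n : Fin m → ℤ => ‖torusFourierCoeff f (n + d)‖ ^ p :=
      hs.comp_injective (Equiv.addRight d).injective
    have h2 := (Equiv.addRight d).tsum_eq fun k => ‖torusFourierCoeff f k‖ ^ p
    rw [hW, ← h2]
    exact h1.sum_le_tsum T fun n _ => by positivity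
  have hone : ∀ n ∈ T, B ^ p ≤ (P.card : ℝ) ^ (p - 1) *
      ∑ x ∈ P, ‖torusFourierCoeff f (n + fun j => ((x j).2 : ℤ) - (x j).1)‖ ^ p := by
    intro n hn
    have h1 := Real.rpow_le_rpow hB (hT n hn) hp0.le
    have h2 := Real.rpow_sum_le_const_mul_sum_rpow P
      (fun x => ‖torusFourierCoeff f fun j => n j - (x j).1 + (x j).2‖) hp
    simp only [abs_norm] at h2
    refine (h1.trans h2).trans_eq ?_
    congr 1
    refine Finset.sum_congr rfl fun x _ => ?_
    congr 3
    funext j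
    simp only [Pi.add_apply]
    ring
  have hsum : (T.card : ℝ) * B ^ p ≤ (P.card : ℝ) ^ p * W := by
    calc (T.card : ℝ) * B ^ p = ∑ n ∈ T, B ^ p := by simp
      _ ≤ ∑ n ∈ T, (P.card : ℝ) ^ (p - 1) *
          ∑ x ∈ P, ‖torusFourierCoeff f (n + fun j => ((x j).2 : ℤ) - (x j).1)‖ ^ p :=
          Finset.sum_le_sum hone
      _ = (P.card : ℝ) ^ (p - 1) * ∑ x ∈ P, ∑ n ∈ T,
          ‖torusFourierCoeff f (n + fun j => ((x j).2 : ℤ) - (x j).1)‖ ^ p := by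
          rw [← Finset.mul_sum, Finset.sum_comm]
      _ ≤ (P.card : ℝ) ^ (p - 1) * ∑ x ∈ P, W := by
          gcongr with x _
          exact hshift _
      _ = (P.card : ℝ) ^ p * W := by
          rw [Finset.sum_const, nsmul_eq_mul, ← mul_assoc]
          congr 1
          rcases Nat.eq_zero_or_pos P.card with h | h
          · simp [h, hp0.ne']
          · rw [← Real.rpow_add_one (by positivity), sub_add_cancel]
  have hroot := Real.rpow_le_rpow (by positivity) hsum (by positivity : 0 ≤ 1 / p)
  rw [Real.mul_rpow (by positivity) (by positivity), Real.mul_rpow (by positivity) hW0,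
    ← Real.rpow_mul hB, ← Real.rpow_mul (by positivity), mul_one_div_cancel hp0.ne',
    Real.rpow_one, Real.rpow_one, hPc] at hroot
  exact hroot

theorem volume_unit_cube {m : ℕ} (c : Fin m → ℝ) :
    volume {t : Space m | ∀ j, |t j - c j| ≤ 1 / 2} = 1 := by
  have e : {t : Space m | ∀ j, |t j - c j| ≤ 1 / 2} =
      (WithLp.ofLp : Space m → Fin m → ℝ) ⁻¹'
        (Set.univ.pi fun j => Set.Icc (c j - 1 / 2) (c j + 1 / 2)) := by
    ext t
    simp only [Set.mem_ofPred_eq, Set.mem_preimage, Set.mem_univ_pi, Set.mem_Icc, abs_le]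
    exact forall_congr' fun j => ⟨fun h => ⟨by linarith [h.1], by linarith [h.2]⟩,
      fun h => ⟨by linarith [h.1], by linarith [h.2]⟩⟩
  rw [e, (PiLp.volume_preserving_ofLp (Fin m)).measure_preimage
    (MeasurableSet.univ_pi fun j => measurableSet_Icc).nullMeasurableSet, volume_pi_pi]
  refine Finset.prod_eq_one fun j _ => ?_
  rw [Real.volume_Icc]
  norm_num

open scoped Pointwise in
/-- A dilate of a set of positive measure is near at least as many lattice points as the measure
of the dilate. -/
theorem exists_finset_near_dilate {m : ℕ} {E : Set (Space m)} {v : ℝ}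
    (hvE : ENNReal.ofReal v ≤ volume E) (lam : ℝ) :
    ∃ T : Finset (Fin m → ℤ), |lam| ^ m * v ≤ T.card ∧
      ∀ n ∈ T, ∃ w ∈ E, ∀ j, |lam * w j - n j| ≤ 1 / 2 := by
  set S : Set (Fin m → ℤ) := {n | ∃ w ∈ E, ∀ j, |lam * w j - n j| ≤ 1 / 2} with hS
  by_cases hfin : S.Finite
  · refine ⟨hfin.toFinset, ?_, fun n hn => hfin.mem_toFinset.1 hn⟩
    -- Rounding coordinates places each point of the dilate in a unit cube centred at an admissible
    -- lattice point, so the measure is at most the number of cubes.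
    have hcov : lam • E ⊆ ⋃ n ∈ hfin.toFinset, {t : Space m | ∀ j, |t j - (n j : ℝ)| ≤ 1 / 2} := by
      rintro _ ⟨w, hw, rfl⟩
      have h1 : ∀ j, |lam * w j - (round (lam * w j) : ℤ)| ≤ 1 / 2 := fun j => abs_sub_round _
      simp only [Set.mem_iUnion]
      exact ⟨fun j => round (lam * w j), hfin.mem_toFinset.2 ⟨w, hw, h1⟩, h1⟩
    have h2 := (measure_mono hcov).trans (measure_biUnion_finset_le (μ := volume) _ _)
    simp only [volume_unit_cube (m := m), Finset.sum_const, nsmul_eq_mul, mul_one] at h2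
    rw [Measure.addHaar_smul, finrank_euclideanSpace_fin, abs_pow] at h2
    have h3 : ENNReal.ofReal (|lam| ^ m * v) ≤ (hfin.toFinset.card : ℝ≥0∞) := by
      rw [ENNReal.ofReal_mul (by positivity)]
      exact (mul_le_mul_right hvE _).trans h2
    rw [← ENNReal.ofReal_natCast] at h3
    exact (ENNReal.ofReal_le_ofReal_iff (by positivity)).1 h3
  · obtain ⟨T, hTS, hT⟩ := Set.Infinite.exists_subset_card_eq hfin ⌈|lam| ^ m * v⌉₊
    exact ⟨T, by rw [hT]; exact Nat.le_ceil _, fun n hn => hTS hn⟩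

/-! ### Linearization of the phase near a point -/

theorem norm_le_card_mul {m : ℕ} (hm : 1 ≤ m) {s : Space m} {r : ℝ} (hr : 0 ≤ r)
    (hs : ∀ j, |s j| ≤ r) : ‖s‖ ≤ m * r := by
  have hm' : (1 : ℝ) ≤ m := by exact_mod_cast hm
  refine abs_le_of_sq_le_sq' ?_ (by positivity) |>.2
  rw [EuclideanSpace.norm_sq_eq]
  calc ∑ j, ‖s j‖ ^ 2 ≤ ∑ _j : Fin m, r ^ 2 :=
        Finset.sum_le_sum fun j _ => pow_le_pow_left₀ (norm_nonneg _) (hs j) 2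
    _ = m * r ^ 2 := by simp
    _ ≤ (m * r) ^ 2 := by nlinarith [sq_nonneg r, mul_nonneg (sub_nonneg.2 hm') (sq_nonneg r)]

/-- Mean value inequality for φ minus its linear part at t₀, whose derivative has norm at most mK on
the ball. -/
theorem abs_sub_sub_sum_gradient_le {m : ℕ} {φ : Space m → ℝ} (hφ : Differentiable ℝ φ)
    {t₀ : Space m} {δ K : ℝ} (hK0 : 0 ≤ K)
    (hK : ∀ j t, ‖t - t₀‖ ≤ δ → |gradient φ t j - gradient φ t₀ j| ≤ K)
    {t : Space m} (ht : ‖t - t₀‖ ≤ δ) :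
    |φ t - φ t₀ - ∑ j, gradient φ t₀ j * (t - t₀) j| ≤ m * K * δ := by
  have hδ : 0 ≤ δ := (norm_nonneg _).trans ht
  have hbound : ∀ y ∈ Metric.closedBall t₀ δ, ‖fderiv ℝ φ y - fderiv ℝ φ t₀‖ ≤ m * K := by
    intro y hy
    refine ContinuousLinearMap.opNorm_le_bound _ (by positivity) fun w => ?_
    rw [_root_.sub_apply, fderiv_apply_eq_sum, fderiv_apply_eq_sum,
      ← Finset.sum_sub_distrib]
    calc ‖∑ j, (gradient φ y j * w j - gradient φ t₀ j * w j)‖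
        ≤ ∑ j : Fin m, K * ‖w‖ := by
          refine (norm_sum_le _ _).trans (Finset.sum_le_sum fun j _ => ?_)
          rw [← sub_mul, norm_mul]
          exact mul_le_mul (hK j y (by rwa [← dist_eq_norm])) (PiLp.norm_apply_le w j)
            (norm_nonneg _) hK0
      _ = m * K * ‖w‖ := by simp; ring
  have := (convex_closedBall t₀ δ).norm_image_sub_le_of_norm_fderiv_le'
    (fun y _ => hφ y) hbound (Metric.mem_closedBall_self hδ)
    (by rwa [Metric.mem_closedBall, dist_eq_norm])
  rw [fderiv_apply_eq_sum] at this
  exact this.trans (mul_le_mul_of_nonneg_left ht (by positivity))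

theorem IsTorusPeriodic.sub_eq {m : ℕ} {F : Type*} {f : Space m → F} (hf : IsTorusPeriodic f)
    (l : Fin m → ℤ) (t : Space m) :
    f (t - WithLp.toLp 2 fun j => (l j : ℝ) * (2 * Real.pi)) = f t := by
  have hj : ∀ j, Function.Periodic f (l j • EuclideanSpace.single j (2 * Real.pi)) := fun j =>
    Function.Periodic.zsmul (fun t => hf t j) (l j)
  have hsum : ∀ s : Finset (Fin m),
      Function.Periodic f (∑ j ∈ s, l j • EuclideanSpace.single j (2 * Real.pi)) := by
    intro s
    induction s using Finset.induction_on with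
    | empty => intro t; simp
    | insert j s hjs ih =>
      rw [Finset.sum_insert hjs]
      exact (hj j).add_period ih
  have e : (WithLp.toLp 2 fun j => (l j : ℝ) * (2 * Real.pi)) =
      ∑ j, l j • EuclideanSpace.single j (2 * Real.pi) := by
    ext i
    simp [WithLp.ofLp_sum, Finset.sum_apply, Pi.single_apply]
  rw [e]
  exact (hsum Finset.univ).sub_eq t

theorem norm_expPhase {m : ℕ} (φ : Space m → ℝ) (lam : ℝ) (t : Space m) :
    ‖expPhase φ lam t‖ = 1 := by
  unfold expPhase
  rw [mul_comm, Complex.norm_exp_ofReal_mul_I]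

theorem norm_exp_sub_exp_le (a b : ℝ) :
    ‖Complex.exp (Complex.I * (a : ℂ)) - Complex.exp (Complex.I * (b : ℂ))‖ ≤ |a - b| := by
  have e : Complex.exp (Complex.I * (a : ℂ)) - Complex.exp (Complex.I * (b : ℂ)) =
      Complex.exp (Complex.I * (b : ℂ)) * (Complex.exp (Complex.I * ((a - b : ℝ) : ℂ)) - 1) := by
    rw [mul_sub, ← Complex.exp_add, mul_one]
    congr 2
    push_cast
    ring
  rw [e, norm_mul, mul_comm Complex.I, Complex.norm_exp_ofReal_mul_I, one_mul]
  exact Real.norm_exp_I_mul_ofReal_sub_one_le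

theorem sq_div_le_one_sub_cos {x : ℝ} (hx : |x| ≤ Real.pi) :
    2 / Real.pi ^ 2 * x ^ 2 ≤ 1 - Real.cos x := by
  linarith [Real.cos_le_one_sub_mul_cos_sq hx]

/-- Modulo periods, either all coordinates of t - t₀ are at most r and the phase moves by at most
1/8, or some coordinate exceeds r. In the latter case 1 - cos ≥ 2r²/π², and the factor π²/r² makes
the right side exceed the trivial bound 2. -/
theorem norm_expPhase_mul_exp_sub_le {m : ℕ} (hm : 1 ≤ m) {φ : Space m → ℝ}
    (hper : IsTorusPeriodic φ) (hφ : Differentiable ℝ φ) {t₀ : Space m} {r K lam : ℝ} (hr : 0 < r)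
    (hK0 : 0 ≤ K)
    (hK : ∀ j t, ‖t - t₀‖ ≤ m * r → |gradient φ t j - gradient φ t₀ j| ≤ K)
    {n : Fin m → ℤ} (hn : ∀ j, |lam * gradient φ t₀ j - n j| ≤ 1 / 2)
    (hsmall : |lam| * (m * K * (m * r)) + m / 2 * r ≤ 1 / 8) (t : Space m) :
    ‖expPhase φ lam t * Complex.exp (-Complex.I * ((∑ j, n j * (t j - t₀ j) : ℝ) : ℂ)) -
        expPhase φ lam t₀‖ ≤
      1 / 8 + Real.pi ^ 2 / r ^ 2 * ∑ j, (1 - Real.cos (t j - t₀ j)) := by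
  have hpi := Real.pi_pos
  set l : Fin m → ℤ := fun j => round ((t j - t₀ j) / (2 * Real.pi)) with hl
  set t' : Space m := t - WithLp.toLp 2 fun j => (l j : ℝ) * (2 * Real.pi) with ht'
  have hcoord : ∀ j, t j - t₀ j = (t' - t₀) j + l j * (2 * Real.pi) := by
    intro j
    simp only [ht', PiLp.sub_apply]
    ring
  have hφt : φ t = φ t' := (hper.sub_eq l t).symm
  have hcos : ∀ j, Real.cos (t j - t₀ j) = Real.cos ((t' - t₀) j) := by
    intro j
    rw [hcoord, Real.cos_add_int_mul_two_pi]
  have hle : ∀ j, |(t' - t₀) j| ≤ Real.pi := by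
    intro j
    have h1 := abs_sub_round ((t j - t₀ j) / (2 * Real.pi))
    have h2 : (t' - t₀) j = ((t j - t₀ j) / (2 * Real.pi) - l j) * (2 * Real.pi) := by
      rw [hcoord]; field_simp; ring
    rw [h2, abs_mul, abs_of_pos (by positivity : 0 < 2 * Real.pi)]
    calc _ ≤ 1 / 2 * (2 * Real.pi) := mul_le_mul_of_nonneg_right h1 (by positivity)
      _ = Real.pi := by ring
  -- The frequencies n are integers, so moving t by periods does not change this exponential.
  have hexp : Complex.exp (-Complex.I * ((∑ j, n j * (t j - t₀ j) : ℝ) : ℂ)) =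
      Complex.exp (-Complex.I * ((∑ j, n j * (t' - t₀) j : ℝ) : ℂ)) := by
    rw [Complex.exp_eq_exp_iff_exists_int]
    refine ⟨-∑ j, n j * l j, ?_⟩
    simp only [hcoord, mul_add, Finset.sum_add_distrib]
    push_cast
    have e : ∑ j, (n j : ℂ) * ((l j : ℂ) * (2 * (Real.pi : ℂ))) =
        (∑ j, (n j : ℂ) * (l j : ℂ)) * (2 * (Real.pi : ℂ)) := by
      rw [Finset.sum_mul]
      exact Finset.sum_congr rfl fun j _ => by ring
    rw [e]
    ring
  have hcosn : ∀ j, 0 ≤ 1 - Real.cos (t j - t₀ j) := fun j => by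
    linarith [Real.cos_le_one (t j - t₀ j)]
  have hsumn : 0 ≤ ∑ j, (1 - Real.cos (t j - t₀ j)) := Finset.sum_nonneg fun j _ => hcosn j
  by_cases hall : ∀ j, |(t' - t₀) j| ≤ r
  · have hnorm : ‖t' - t₀‖ ≤ m * r := norm_le_card_mul hm hr.le hall
    have htay := abs_sub_sub_sum_gradient_le hφ hK0 hK hnorm
    have hlin : |∑ j, (lam * gradient φ t₀ j - n j) * (t' - t₀) j| ≤ m / 2 * r := by
      refine (Finset.abs_sum_le_sum_abs _ _).trans ?_
      calc _ ≤ ∑ _j : Fin m, 1 / 2 * r := by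
            refine Finset.sum_le_sum fun j _ => ?_
            rw [abs_mul]
            exact mul_le_mul (hn j) (hall j) (abs_nonneg _) (by norm_num)
        _ = m / 2 * r := by simp; ring
    have hphase : |lam * φ t' - ∑ j, n j * (t' - t₀) j - lam * φ t₀| ≤ 1 / 8 := by
      have e : lam * φ t' - ∑ j, n j * (t' - t₀) j - lam * φ t₀ =
          lam * (φ t' - φ t₀ - ∑ j, gradient φ t₀ j * (t' - t₀) j) +
            ∑ j, (lam * gradient φ t₀ j - n j) * (t' - t₀) j := by
        simp only [sub_mul _ _ ((t' - t₀) _), Finset.sum_sub_distrib, mul_sub, Finset.mul_sum,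
          mul_assoc]
        ring
      rw [e]
      refine (abs_add_le _ _).trans ?_
      rw [abs_mul]
      have := mul_le_mul_of_nonneg_left htay (abs_nonneg lam)
      linarith
    have e2 : expPhase φ lam t *
        Complex.exp (-Complex.I * ((∑ j, n j * (t j - t₀ j) : ℝ) : ℂ)) =
        Complex.exp (Complex.I * ((lam * φ t' - ∑ j, n j * (t' - t₀) j : ℝ) : ℂ)) := by
      rw [hexp, expPhase, hφt, ← Complex.exp_add]
      congr 1
      push_cast
      ring
    rw [e2]
    have := (norm_exp_sub_exp_le (lam * φ t' - ∑ j, n j * (t' - t₀) j) (lam * φ t₀)).trans hphase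
    have h3 : 0 ≤ Real.pi ^ 2 / r ^ 2 * ∑ j, (1 - Real.cos (t j - t₀ j)) := by positivity
    unfold expPhase
    linarith
  · push Not at hall
    obtain ⟨j, hj⟩ := hall
    have htwo : ‖expPhase φ lam t *
        Complex.exp (-Complex.I * ((∑ j, n j * (t j - t₀ j) : ℝ) : ℂ)) -
        expPhase φ lam t₀‖ ≤ 2 := by
      refine (norm_sub_le _ _).trans ?_
      rw [norm_mul, norm_expPhase, norm_expPhase, neg_mul, ← mul_neg, ← Complex.ofReal_neg,
        mul_comm Complex.I, Complex.norm_exp_ofReal_mul_I]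
      norm_num
    have h1 : 1 - Real.cos (t j - t₀ j) ≤ ∑ j, (1 - Real.cos (t j - t₀ j)) :=
      Finset.single_le_sum (f := fun j => 1 - Real.cos (t j - t₀ j)) (fun i _ => hcosn i)
        (Finset.mem_univ j)
    have h2 : 2 / Real.pi ^ 2 * r ^ 2 ≤ 1 - Real.cos (t j - t₀ j) := by
      rw [hcos]
      refine le_trans ?_ (sq_div_le_one_sub_cos (hle j))
      rw [← sq_abs ((t' - t₀) j)]
      gcongr
    have h3 : 2 ≤ Real.pi ^ 2 / r ^ 2 * ∑ j, (1 - Real.cos (t j - t₀ j)) := by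
      calc (2 : ℝ) = Real.pi ^ 2 / r ^ 2 * (2 / Real.pi ^ 2 * r ^ 2) := by field_simp
        _ ≤ _ := mul_le_mul_of_nonneg_left (h2.trans h1) (by positivity)
    linarith


/-! ### Lower bound for one window of coefficients -/

theorem le_sum_norm_torusFourierCoeff {m : ℕ} (hm : 1 ≤ m) {φ : Space m → ℝ}
    (hper : IsTorusPeriodic φ) (hφ : ContDiff ℝ 1 φ) {t₀ : Space m} {r K lam : ℝ} (hr : 0 < r)
    (hK0 : 0 ≤ K)
    (hK : ∀ j t, ‖t - t₀‖ ≤ m * r → |gradient φ t j - gradient φ t₀ j| ≤ K)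
    {n : Fin m → ℤ} (hn : ∀ j, |lam * gradient φ t₀ j - n j| ≤ 1 / 2)
    (hsmall : |lam| * (m * K * (m * r)) + m / 2 * r ≤ 1 / 8)
    {N : ℕ} (hN : 2 ≤ N) (hNr : 60 * m / r ≤ N) :
    (2 * (N : ℝ) / 5) ^ m / 2 ≤
      ∑ x ∈ Fintype.piFinset fun _ : Fin m => Finset.range N ×ˢ Finset.range N,
        ‖torusFourierCoeff (expPhase φ lam) fun j => n j - (x j).1 + (x j).2‖ := by
  have hφc : Continuous φ := hφ.continuous
  have hf : Continuous (expPhase φ lam) := by unfold expPhase; fun_prop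
  have hpi := Real.pi_pos
  have hm' : (1 : ℝ) ≤ m := by exact_mod_cast hm
  have hN0 : (0 : ℝ) < N := by positivity
  -- The factor 60 in `hNr` is chosen for this: 60² = 3600 exceeds 320π².
  have hAN : Real.pi ^ 2 / r ^ 2 * (m * (40 / (N : ℝ) ^ 2)) ≤ 1 / 8 := by
    have h1 : 60 * m ≤ N * r := (div_le_iff₀ hr).1 hNr
    have h2 : (60 * (m : ℝ)) ^ 2 ≤ (N * r) ^ 2 := by gcongr
    have h3 : Real.pi ^ 2 ≤ 3.15 ^ 2 := by
      have := Real.pi_lt_d2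
      gcongr
    have h4 : Real.pi ^ 2 * m ≤ 3.15 ^ 2 * m ^ 2 := by nlinarith
    rw [div_mul_eq_mul_div, div_le_iff₀ (by positivity), ← mul_div_assoc, ← mul_div_assoc,
      div_le_iff₀ (by positivity)]
    nlinarith
  have hlow := norm_integral_mul_torusKernel_ge hN
    (g := fun t => expPhase φ lam t *
      Complex.exp (-Complex.I * ((∑ j, n j * (t j - t₀ j) : ℝ) : ℂ)))
    (by fun_prop) (norm_expPhase φ lam t₀) (by positivity) hAN
    (norm_expPhase_mul_exp_sub_le hm hper (hφ.differentiable one_ne_zero) hr hK0 hK hn hsmall)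
  have hup := norm_integral_mul_torusKernel_le
    (hf.continuousOn.integrableOn_compact (isCompact_cube m)) n t₀ N
  have h := hlow.trans hup
  set W := ∑ x ∈ Fintype.piFinset fun _ : Fin m => Finset.range N ×ˢ Finset.range N,
        ‖torusFourierCoeff (expPhase φ lam) fun j => n j - (x j).1 + (x j).2‖
  have hQ : (2 * Real.pi * ((N : ℝ) ^ 5 / 40)) ^ m ≤ (2 * Real.pi * kernelMass N) ^ m := by
    have := le_sum_parabola_sq hN
    unfold kernelMass
    gcongr
  -- Mass N⁵/40 divided by the largest weight N⁴/16 leaves 2N/5 per coordinate.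
  have e : (2 * Real.pi * ((N : ℝ) ^ 5 / 40)) ^ m =
      ((2 * Real.pi) ^ m * ((N : ℝ) ^ 4 / 16) ^ m) * (2 * (N : ℝ) / 5) ^ m := by
    rw [← mul_pow, ← mul_pow]
    congr 1
    ring
  have hpos : 0 < (2 * Real.pi) ^ m * ((N : ℝ) ^ 4 / 16) ^ m := by positivity
  refine le_of_mul_le_mul_left ?_ hpos
  rw [← mul_div_assoc, ← e]
  linarith

end BeurlingHelson

/-! ### Choice of scales and conclusion -/

theorem theorem1 (m : ℕ) (hm : 1 ≤ m) (p : ℝ) (hp : 1 ≤ p) (hp2 : p < 2)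
    (ω : ℝ → ℝ) (hω_cont : ContinuousOn ω (Set.Ici 0)) (hω_mono : MonotoneOn ω (Set.Ici 0))
    (hω_zero : ω 0 = 0)
    (φ : BeurlingHelson.Space m → ℝ) (hφ : BeurlingHelson.MemC1 ω φ)
    (hgrad : 0 < volume (Set.range (gradient φ))) :
    Set.BijOn (BeurlingHelson.chi ω) (Set.Ici 0) (Set.Ici 0) ∧
    ∃ c : ℝ, 0 < c ∧ ∀ lam ∈ BeurlingHelson.Lambda φ p, 1 ≤ |lam| →
      c * (|lam| ^ (1 / p) * BeurlingHelson.chiInv ω (1 / |lam|)) ^ m ≤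
        BeurlingHelson.normA p (BeurlingHelson.expPhase φ lam) := by
  open BeurlingHelson in
  have hω_pos : ∀ x, 0 < x → 0 < ω x := fun x hx => hφ.omega_pos hm hω_mono hω_zero hgrad hx
  have hbij := bijOn_chi hω_cont hω_mono hω_zero hω_pos
  refine ⟨hbij, ?_⟩
  have hm' : (1 : ℝ) ≤ m := by exact_mod_cast hm
  have hinv : ∀ y, 0 < y → 0 < chiInv ω y ∧ chi ω (chiInv ω y) = y := by
    intro y hy
    have hmem : y ∈ chi ω '' Set.Ici 0 := hbij.surjOn hy.le
    have h1 : (0 : ℝ) ≤ chiInv ω y := Function.invFunOn_mem hmem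
    have h2 : chi ω (chiInv ω y) = y := Function.invFunOn_eq hmem
    refine ⟨lt_of_le_of_ne h1 fun h0 => ?_, h2⟩
    rw [← h0, chi, zero_mul] at h2
    exact hy.ne h2
  obtain ⟨C, hC, δ₀, hδ₀, hlip⟩ := hφ.exists_gradient_sub_le hω_mono hω_zero
  -- The range may have infinite measure, so a finite positive lower bound is taken.
  obtain ⟨v, hv0, hvE⟩ : ∃ v : ℝ, 0 < v ∧ ENNReal.ofReal v ≤ volume (Set.range (gradient φ)) := by
    obtain ⟨q, hq0, hq⟩ := ENNReal.lt_iff_exists_real_btwn.1 hgrad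
    exact ⟨q, ENNReal.ofReal_pos.1 hq.1, hq.2.le⟩
  set X₁ := chiInv ω 1 with hX₁
  obtain ⟨hX₁0, hX₁eq⟩ := hinv 1 one_pos
  -- The three bounds give, in turn, ω(εX) ≤ ω(X), εX < δ₀, and a total phase error mCε + εX₁ of at
  -- most 1/8.
  set ε := min 1 (min (δ₀ / (2 * X₁)) (1 / (8 * (m * C + X₁)))) with hε
  have hε0 : 0 < ε := by
    refine lt_min one_pos (lt_min ?_ ?_) <;> positivity
  have hε1 : ε ≤ 1 := min_le_left _ _
  have hε2 : ε * (2 * X₁) ≤ δ₀ :=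
    (le_div_iff₀ (by positivity)).1 ((min_le_right _ _).trans (min_le_left _ _))
  have hε3 : ε * (8 * (m * C + X₁)) ≤ 1 :=
    (le_div_iff₀ (by positivity)).1 ((min_le_right _ _).trans (min_le_right _ _))
  -- The factor v^{1/p} comes from the lattice count, 1/2 from the retained half of the mass, and
  -- 300m² from Nr ≤ 120m with r = εX/m.
  refine ⟨v ^ (1 / p) * (ε / (300 * m ^ 2)) ^ m / 2, by positivity, fun lam hlam hlam1 => ?_⟩
  have hl0 : 0 < |lam| := by linarith
  obtain ⟨hX0, hXeq⟩ := hinv (1 / |lam|) (by positivity)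
  set X := chiInv ω (1 / |lam|) with hX
  have hXX : X ≤ X₁ := by
    refine ((strictMonoOn_chi hω_mono hω_pos).le_iff_le hX0.le hX₁0.le).1 ?_
    rw [hXeq, hX₁eq]
    exact (div_le_one hl0).2 hlam1
  set r := ε * X / m with hr
  have hr0 : 0 < r := by positivity
  have hmr : m * r = ε * X := by rw [hr]; field_simp
  have hεX : ε * X ≤ ε * X₁ := mul_le_mul_of_nonneg_left hXX hε0.le
  have hδ : ε * X < δ₀ := by nlinarith [mul_pos hε0 hX₁0]
  have hωle : ω (ε * X) ≤ ω X :=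
    hω_mono (by positivity : 0 ≤ ε * X) hX0.le (mul_le_of_le_one_left hX0.le hε1)
  have hωn : 0 ≤ ω (ε * X) := omega_nonneg hω_mono hω_zero (by positivity)
  -- The defining balance of the scale X: it cancels |λ| in the linearization error.
  have hlX : |lam| * (X * ω X) = 1 := by
    have : X * ω X = 1 / |lam| := hXeq
    rw [this]; field_simp
  have hsmall : |lam| * (m * (C * ω (ε * X)) * (m * r)) + m / 2 * r ≤ 1 / 8 := by
    have h1 : |lam| * (m * (C * ω (ε * X)) * (m * r)) ≤ m * C * ε := by
      calc |lam| * (m * (C * ω (ε * X)) * (m * r))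
          = (m * C * ε) * (|lam| * (X * ω (ε * X))) := by rw [hmr]; ring
        _ ≤ (m * C * ε) * (|lam| * (X * ω X)) := by gcongr
        _ = m * C * ε := by rw [hlX, mul_one]
    have h2 : m / 2 * r ≤ ε * X₁ := by
      have : m / 2 * r = ε * X / 2 := by rw [← hmr]; ring
      rw [this]
      linarith [mul_pos hε0 hX0]
    linarith
  have hrle : r ≤ 1 := by
    have h1 : ε * X₁ ≤ 1 := by nlinarith [mul_pos hε0 (mul_pos (by linarith : (0 : ℝ) < m) hC)]
    have h2 : r ≤ m * r := le_mul_of_one_le_left hr0.le hm'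
    linarith
  have h60 : 60 ≤ 60 * m / r := by
    rw [le_div_iff₀ hr0]
    nlinarith
  set N := ⌈60 * m / r⌉₊ with hN
  have hNr : 60 * m / r ≤ N := Nat.le_ceil _
  have hN2 : 2 ≤ N := by
    have : (2 : ℝ) ≤ N := by linarith
    exact_mod_cast this
  have hN0 : (0 : ℝ) < N := by positivity
  -- Because 60m/r ≥ 60, rounding up at most doubles it.
  have hNle : (N : ℝ) ≤ 120 * m / r := by
    have h1 := (Nat.ceil_lt_add_one (by positivity : 0 ≤ 60 * m / r)).le
    have h2 : 120 * m / r = 60 * m / r + 60 * m / r := by ring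
    rw [h2]
    linarith
  obtain ⟨T, hTcard, hT⟩ := exists_finset_near_dilate hvE lam
  have hmain := card_rpow_mul_le_normA hp (f := expPhase φ lam) hlam.summable (N := N)
    (B := (2 * (N : ℝ) / 5) ^ m / 2) (by positivity) T fun n hn => by
      obtain ⟨_, ⟨t₀, rfl⟩, hnear⟩ := hT n hn
      refine le_sum_norm_torusFourierCoeff hm hφ.periodic hφ.contDiff (t₀ := t₀) (r := r)
        (K := C * ω (ε * X)) hr0 (by positivity) (fun j t ht => ?_) hnear hsmall hN2 hNr
      exact hlip (ε * X) (by positivity) hδ j t t₀ (by rwa [← hmr])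
  have hTr : (|lam| ^ (1 / p)) ^ m * v ^ (1 / p) ≤ (T.card : ℝ) ^ (1 / p) := by
    have := Real.rpow_le_rpow (by positivity) hTcard (by positivity : 0 ≤ 1 / p)
    rw [Real.mul_rpow (by positivity) hv0.le, ← Real.rpow_natCast, ← Real.rpow_mul (by positivity),
      mul_comm (m : ℝ), Real.rpow_mul (by positivity), Real.rpow_natCast] at this
    exact this
  have hXN : ε / (300 * m ^ 2) * X ≤ 2 / (5 * N) := by
    rw [le_div_iff₀ (by positivity)]
    have h1 : N * r ≤ 120 * m := (le_div_iff₀ hr0).1 hNle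
    have h2 : N * (ε * X) ≤ 120 * m ^ 2 := by
      rw [← hmr]
      nlinarith
    calc ε / (300 * m ^ 2) * X * (5 * N) = N * (ε * X) / (60 * m ^ 2) := by field_simp; ring
      _ ≤ 2 := by
        rw [div_le_iff₀ (by positivity)]
        linarith
  have hNN : 0 < ((N : ℝ) ^ 2) ^ m := by positivity
  refine le_of_mul_le_mul_left (le_trans ?_ hmain) hNN
  calc ((N : ℝ) ^ 2) ^ m *
        (v ^ (1 / p) * (ε / (300 * m ^ 2)) ^ m / 2 * (|lam| ^ (1 / p) * X) ^ m)
      = ((|lam| ^ (1 / p)) ^ m * v ^ (1 / p)) *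
          (((N : ℝ) ^ 2) ^ m * (ε / (300 * m ^ 2) * X) ^ m / 2) := by
        rw [mul_pow, mul_pow]; ring
    _ ≤ (T.card : ℝ) ^ (1 / p) * (((N : ℝ) ^ 2) ^ m * (2 / (5 * N)) ^ m / 2) := by gcongr
    _ = (T.card : ℝ) ^ (1 / p) * ((2 * (N : ℝ) / 5) ^ m / 2) := by
        rw [← mul_pow]
        congr 3
        field_simp
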